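/- For integers $0<i<j\le n$ and $1\le m\le n$ let $S_{\{i,j\}_n^m}$ denote the multiset obtained from $\{0,1,\dots,m-1,m,m,m+1,\dots,n\}$ (each number of $\{0,\dots,n\}$ once, except $m$, which occurs twice) by deleting all occurrences of $i$ and $j$. A multiset $S$ of elements of $\{0,1,\dots,n\}$ with $|S|=n$ and $0\in S$ is called Laplacian realizable if there is a connected simple graph on $n$ vertices whose Laplacian spectrum (the multiset of eigenvalues, with multiplicity, of the matrix $D(G)-A(G)$, where $D(G)$ is the diagonal matrix of vertex degrees and $A(G)$ is the adjacency matrix) equals $S$; a multiset that does not satisfy these conditions is not Laplacian realizable. Theorem. Let $n\ge 3$ and $0<i<j\le n$. Then $S_{\{i,j\}_n^n}$ is Laplacian realizable if and only if $i=1$ and one of the following holds: (i) $n\equiv 0 \pmod 4$ and $j=2k+1$ for some $k\in\{1,2,\dots,\frac{n-2}{2}\}$; (ii) $n\equiv 1 \pmod 4$ and $j=2k+1$ for some $k\in\{1,2,\dots,\frac{n-3}{2}\}$; (iii) $n\equiv 2 \pmod 4$ and $j=2k$ for some $k\in\{1,2,\dots,\frac{n-2}{2}\}$; (iv) $n\equiv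 3 \pmod 4$ and $j=2k$ for some $k\in\{1,2,\dots,\frac{n-1}{2}\}$. -/

import Mathlib

open Classical in
/-- The Laplacian spectrum of a finite simple graph: the multiset of the eigenvalues, with
algebraic multiplicity, of the real symmetric matrix `L(G) = D(G) - A(G)`. -/
noncomputable def laplacianSpectrum {V : Type*} [Fintype V] [DecidableEq V]
    (G : SimpleGraph V) : Multiset ℝ :=
  (G.lapMatrix ℝ).charpoly.roots

/-- A "set with possible repetitions" `S` of elements of `{0, 1, …, n}` with `|S| = n` and `0 ∈ S`
is Laplacian realizable if it is the Laplacian spectrum of a connected simple graph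
on `n` vertices. -/
def LaplacianRealizable (n : ℕ) (S : Multiset ℕ) : Prop :=
  (∀ x ∈ S, x ≤ n) ∧ S.card = n ∧ 0 ∈ S ∧
    ∃ G : SimpleGraph (Fin n), G.Connected ∧
      laplacianSpectrum G = S.map (fun x : ℕ => (x : ℝ))

/-- The multiset `{0, 1, …, m - 1, m, m, m + 1, …, n} \ {i, j}`: the number `m` is doubled,
and the numbers `i` and `j` do not occur (every copy of them is deleted). -/
def doubledSet (n m i j : ℕ) : Multiset ℕ :=
  (m ::ₘ Multiset.range (n + 1)).filter (fun x => x ≠ i ∧ x ≠ j)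

/-! Everything is read off the complement, whose spectrum keeps one 0 and turns every other
eigenvalue `a` into `n - a` (`laplacianSpectrum_compl`). A double `n` forces at least three
components there. If `i ≠ 1`, then 1 survives and the complement has eigenvalue `n - 1`, but an
eigenvalue is at most the order of some component, here at most `n - 2`. The trace is twice the
number of edges, which fixes the parity of `j`; `j = n` fails by cardinality. Conversely, the
complement is (for `n > 3`) a disjoint union of two tiny graphs and a graph on `M` vertices with
spectrum `{0, …, M}` minus one value, supplied by `Icc_erase`. -/

/-! ### Laplacian spectra under sums and complements; components -/

open Polynomial in
/-- The Laplacian characteristic polynomial is the product of the linear factors given by the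
Laplacian spectrum. -/
theorem charpoly_lapMatrix_eq_prod {V : Type*} [Fintype V] [DecidableEq V] (G : SimpleGraph V)
    [DecidableRel G.Adj] :
    (G.lapMatrix ℝ).charpoly = ((laplacianSpectrum G).map fun a => X - C a).prod := by
  classical
  have h := (G.isHermitian_lapMatrix ℝ).splits_charpoly
  rw [← prod_multiset_X_sub_C_of_monic_of_roots_card_eq (Matrix.charpoly_monic _)
    (splits_iff_card_roots.mp h)]
  simp only [laplacianSpectrum]
  congr!

open Polynomial in
theorem laplacianSpectrum_eq_of_charpoly {V : Type*} [Fintype V] [DecidableEq V]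
    {G : SimpleGraph V} [DecidableRel G.Adj] {s : Multiset ℝ}
    (h : (G.lapMatrix ℝ).charpoly = (s.map fun a => X - C a).prod) : laplacianSpectrum G = s := by
  rw [charpoly_lapMatrix_eq_prod] at h
  simpa [roots_multiset_prod_X_sub_C] using congrArg roots h

theorem mem_laplacianSpectrum_iff {V : Type*} [Fintype V] [DecidableEq V] {G : SimpleGraph V}
    [DecidableRel G.Adj] {μ : ℝ} :
    μ ∈ laplacianSpectrum G ↔ ∃ v : V → ℝ, v ≠ 0 ∧ (G.lapMatrix ℝ).mulVec v = μ • v := by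
  have h : μ ∈ laplacianSpectrum G ↔ (G.lapMatrix ℝ).charpoly.eval μ = 0 := by
    simp [charpoly_lapMatrix_eq_prod, Polynomial.eval_multiset_prod, Multiset.prod_eq_zero_iff,
      sub_eq_zero]
  rw [h, Matrix.eval_charpoly, ← Matrix.exists_mulVec_eq_zero_iff]
  refine exists_congr fun v => and_congr_right fun _ => ?_
  rw [Matrix.sub_mulVec, sub_eq_zero, eq_comm, Matrix.scalar_apply, ← Matrix.smul_one_eq_diagonal,
    Matrix.smul_mulVec, Matrix.one_mulVec]

theorem laplacianSpectrum_congr {V W : Type*} [Fintype V] [DecidableEq V] [Fintype W]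
    [DecidableEq W] {G : SimpleGraph V} {H : SimpleGraph W} (e : G ≃g H) :
    laplacianSpectrum G = laplacianSpectrum H := by
  classical
  apply laplacianSpectrum_eq_of_charpoly
  rw [← charpoly_lapMatrix_eq_prod, ← Matrix.charpoly_reindex e.toEquiv]
  congr 1
  ext a b
  have hd : G.degree (e.symm a) = H.degree a := by
    conv_rhs => rw [← e.apply_symm_apply a]
    exact (e.degree_eq _).symm
  have ha : G.Adj (e.symm a) (e.symm b) ↔ H.Adj a b := e.symm.map_adj_iff
  change G.lapMatrix ℝ (e.symm a) (e.symm b) = _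
  simp [SimpleGraph.lapMatrix, SimpleGraph.degMatrix, Matrix.diagonal_apply,
    SimpleGraph.adjMatrix_apply, ha, hd]

theorem laplacianSpectrum_sum {V W : Type*} [Fintype V] [DecidableEq V] [Fintype W]
    [DecidableEq W] (G : SimpleGraph V) (H : SimpleGraph W) :
    laplacianSpectrum (G.sum H) = laplacianSpectrum G + laplacianSpectrum H := by
  classical
  apply laplacianSpectrum_eq_of_charpoly
  have h : (G.sum H).lapMatrix ℝ = Matrix.fromBlocks (G.lapMatrix ℝ) 0 0 (H.lapMatrix ℝ) := by
    ext (a | a) (b | b) <;>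
      simp only [SimpleGraph.lapMatrix, SimpleGraph.degMatrix, Matrix.diagonal_apply,
        SimpleGraph.adjMatrix_apply, Matrix.sub_apply, SimpleGraph.degree_eq_sum_if_adj,
        Fintype.sum_sum_type] <;>
      simp [Matrix.diagonal_apply]
  rw [h, Matrix.charpoly_fromBlocks_zero₁₂, charpoly_lapMatrix_eq_prod, charpoly_lapMatrix_eq_prod,
    Multiset.map_add, Multiset.prod_add]

theorem sum_laplacianSpectrum {V : Type*} [Fintype V] [DecidableEq V] (G : SimpleGraph V)
    [DecidableRel G.Adj] : (laplacianSpectrum G).sum = ((2 * G.edgeFinset.card : ℕ) : ℝ) := by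
  classical
  have h := Matrix.trace_eq_sum_roots_charpoly_of_splits
    (G.isHermitian_lapMatrix ℝ).splits_charpoly
  have hs : laplacianSpectrum G = (G.lapMatrix ℝ).charpoly.roots := by
    rw [laplacianSpectrum]; congr!
  rw [hs, ← h, ← G.sum_degrees_eq_twice_card_edges]
  simp [Matrix.trace, SimpleGraph.lapMatrix, SimpleGraph.degMatrix]

/-- The Laplacian is symmetric, so the algebraic multiplicity of 0 is the dimension of the kernel.
-/
theorem card_connectedComponent_eq_count_zero {V : Type*} [Fintype V] [DecidableEq V]
    (G : SimpleGraph V) : Nat.card G.ConnectedComponent = (laplacianSpectrum G).count 0 := by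
  classical
  rw [Nat.card_eq_fintype_card, G.card_connectedComponent_eq_finrank_ker_toLin'_lapMatrix]
  have hA := G.isHermitian_lapMatrix ℝ
  have h1 := (G.lapMatrix ℝ).toLin'.finrank_range_add_finrank_ker
  have h2 : Module.finrank ℝ (LinearMap.range (G.lapMatrix ℝ).toLin') = (G.lapMatrix ℝ).rank := rfl
  have hs : laplacianSpectrum G = (G.lapMatrix ℝ).charpoly.roots := by
    rw [laplacianSpectrum]
  have h3 : (laplacianSpectrum G).count 0 = Fintype.card {i // ¬ hA.eigenvalues i ≠ 0} := by
    rw [hs, hA.roots_charpoly_eq_eigenvalues, Multiset.count_map, Fintype.card_subtype]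
    simp [Finset.card_def, eq_comm]
  rw [h2, hA.rank_eq_card_non_zero_eigs, Module.finrank_fintype_fun_eq_card] at h1
  rw [h3, Fintype.card_subtype_compl]
  omega

open Polynomial in
theorem laplacianSpectrum_compl {V : Type*} [Fintype V] [DecidableEq V] {G : SimpleGraph V}
    {s : Multiset ℝ} (h : laplacianSpectrum G = 0 ::ₘ s) :
    laplacianSpectrum Gᶜ = 0 ::ₘ s.map fun a => (Fintype.card V : ℝ) - a := by
  classical
  set N := Fintype.card V with hN
  set L := G.lapMatrix ℝ
  have hcard : s.card + 1 = N := by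
    have := congrArg natDegree (charpoly_lapMatrix_eq_prod G)
    rw [Matrix.charpoly_natDegree_eq_dim, h, natDegree_multiset_prod_X_sub_C_eq_card] at this
    simpa [eq_comm] using this
  have hL : Gᶜ.lapMatrix ℝ
      = (N : ℝ) • (1 : Matrix V V ℝ) - Matrix.of (fun _ _ => 1) - L := by
    ext a b
    have hd : (Gᶜ.degree a : ℝ) = N - 1 - G.degree a := by
      have := G.degree_compl a
      have h2 := G.degree_lt_card_verts a
      rw [this, Nat.sub_sub, Nat.cast_sub (by omega)]
      push_cast; ring
    by_cases hab : a = b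
    · subst hab
      simp [L, SimpleGraph.lapMatrix, SimpleGraph.degMatrix, hd]
    · by_cases hG : G.Adj a b <;>
        simp [L, SimpleGraph.lapMatrix, SimpleGraph.degMatrix, hab, SimpleGraph.adjMatrix_apply, hG]
  apply laplacianSpectrum_eq_of_charpoly
  -- Since `L` kills the all-ones vector, subtracting the all-ones matrix from `yI - L` is a
  -- rank-one factor; the matrix determinant lemma evaluates it.
  have key (y : ℝ) (hy : y ≠ 0) :
      y * (y • (1 : Matrix V V ℝ) - L - Matrix.of (fun _ _ => 1)).det
        = (y - N) * (y • (1 : Matrix V V ℝ) - L).det := by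
    have hfac : y • (1 : Matrix V V ℝ) - L - Matrix.of (fun _ _ => 1)
        = (y • (1 : Matrix V V ℝ) - L) *
          (1 + Matrix.replicateCol Unit (fun _ : V => -y⁻¹) *
            Matrix.replicateRow Unit (fun _ : V => (1 : ℝ))) := by
      have h1 : L.mulVec (fun _ => 1) = 0 := G.lapMatrix_mulVec_const_eq_zero
      have h2 (a : V) : ∑ b, L a b = 0 := by
        simpa [Matrix.mulVec, dotProduct] using congrFun h1 a
      ext a b
      simp [mul_add, Matrix.mul_apply, sub_mul, Finset.sum_add_distrib, Finset.sum_sub_distrib,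
        ← Finset.sum_mul, h2, Matrix.one_apply, hy]
      ring
    rw [hfac, Matrix.det_mul, Matrix.det_one_add_replicateCol_mul_replicateRow]
    simp only [dotProduct, mul_neg, Finset.sum_neg_distrib, Finset.sum_const, Finset.card_univ,
      ← hN, nsmul_eq_mul, one_mul]
    field_simp
    ring
  refine eq_of_infinite_eval_eq _ _ (Set.Infinite.mono (s := ({(N : ℝ)} : Set ℝ)ᶜ) ?_
    (Set.finite_singleton _).infinite_compl)
  intro x hx
  have hx' : (N : ℝ) - x ≠ 0 := sub_ne_zero.mpr (Ne.symm hx)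
  have hk := key (N - x) hx'
  have e1 : (Gᶜ.lapMatrix ℝ).charpoly.eval x = (-1) ^ N *
      (((N : ℝ) - x) • (1 : Matrix V V ℝ) - L - Matrix.of (fun _ _ => 1)).det := by
    rw [Matrix.eval_charpoly, hN, ← Matrix.det_neg, hL, Matrix.scalar_apply,
      ← Matrix.smul_one_eq_diagonal, ← hN]
    congr 1
    module
  have e2 : (((N : ℝ) - x) • (1 : Matrix V V ℝ) - L).det
      = ((N : ℝ) - x) * (s.map fun a => (N : ℝ) - x - a).prod := by
    rw [Matrix.smul_one_eq_diagonal, ← Matrix.scalar_apply, ← Matrix.eval_charpoly,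
      charpoly_lapMatrix_eq_prod, h]
    simp [eval_multiset_prod]
  have e3 : (s.map fun a => x - ((N : ℝ) - a)).prod
      = (-1) ^ s.card * (s.map fun a => (N : ℝ) - x - a).prod := by
    rw [← Multiset.card_map (fun a => (N : ℝ) - x - a), ← Multiset.prod_map_neg, Multiset.map_map]
    congr 2
    ext a
    simp only [Function.comp_apply]
    ring
  change eval x _ = eval x _
  rw [e1]
  rw [e2] at hk
  have hk' := mul_left_cancel₀ hx' (hk.trans (by ring : _ = ((N : ℝ) - x) *
    ((N - x - N) * (s.map fun a => (N : ℝ) - x - a).prod)))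
  rw [hk']
  simp only [Multiset.map_cons, Multiset.prod_cons, eval_mul, eval_multiset_prod, Multiset.map_map,
    Function.comp_def, eval_sub, eval_X, eval_C]
  rw [e3, ← hcard, pow_succ]
  ring

/-- Every Laplacian eigenvalue is bounded by the size of some connected component. -/
theorem le_card_supp_of_mem_laplacianSpectrum {V : Type*} [Fintype V] [DecidableEq V]
    {G : SimpleGraph V} {μ : ℝ} (h : μ ∈ laplacianSpectrum G) :
    ∃ c : G.ConnectedComponent, μ ≤ c.supp.ncard := by
  classical
  obtain ⟨v, hv, hLv⟩ := mem_laplacianSpectrum_iff.mp h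
  obtain ⟨a, ha⟩ := Function.ne_iff.mp hv
  refine ⟨G.connectedComponentMk a, ?_⟩
  set c := G.connectedComponentMk a
  let S : Finset V := Finset.univ.filter fun x => G.connectedComponentMk x = c
  have hS : (c.supp.ncard : ℝ) = S.card := by
    rw [← Set.ncard_coe_finset]
    congr 2
    ext x
    simp [S]
  rw [hS]
  have hadj {x y : V} (hxy : G.Adj x y) : x ∈ S ↔ y ∈ S := by
    simp [S, SimpleGraph.ConnectedComponent.sound hxy.reachable]
  -- The restriction of an eigenvector to a component is again an eigenvector.
  let w : V → ℝ := fun x => if x ∈ S then v x else 0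
  have hLw : (G.lapMatrix ℝ).mulVec w = μ • w := by
    ext x
    have hx := congrFun hLv x
    rw [SimpleGraph.lapMatrix_mulVec_apply] at hx ⊢
    by_cases hxS : x ∈ S
    · have : ∑ u ∈ G.neighborFinset x, w u = ∑ u ∈ G.neighborFinset x, v u :=
        Finset.sum_congr rfl fun u hu =>
          if_pos ((hadj ((G.mem_neighborFinset x u).mp hu)).mp hxS)
      rw [this]
      simpa [w, hxS] using hx
    · have : ∑ u ∈ G.neighborFinset x, w u = 0 :=
        Finset.sum_eq_zero fun u hu =>
          if_neg (mt (hadj ((G.mem_neighborFinset x u).mp hu)).mpr hxS)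
      rw [this]
      simp [w, hxS]
  have hq := G.lapMatrix_toLinearMap₂' ℝ w
  rw [Matrix.toLinearMap₂'_apply', hLw, dotProduct_smul, smul_eq_mul] at hq
  have hww : w ⬝ᵥ w = ∑ x ∈ S, v x ^ 2 := by
    simp [dotProduct, w, pow_two]
  have hpos : 0 < w ⬝ᵥ w := by
    rw [hww]
    exact Finset.sum_pos' (fun _ _ => sq_nonneg _)
      ⟨a, by simp [S, c], sq_pos_of_ne_zero ha⟩
  -- The quadratic form only grows when the component is completed to a clique.
  have hle : (∑ i : V, ∑ j : V, if G.Adj i j then (w i - w j) ^ 2 else 0)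
      ≤ ∑ i ∈ S, ∑ j ∈ S, (v i - v j) ^ 2 := by
    have hS (f : V → ℝ) : ∑ i ∈ S, f i = ∑ i, if i ∈ S then f i else 0 := by simp
    simp only [hS]
    refine Finset.sum_le_sum fun i _ => ?_
    split_ifs with hi
    · refine Finset.sum_le_sum fun j _ => ?_
      split_ifs with hij hj hj
      · simp [w, hi, hj]
      · exact absurd ((hadj hij).mp hi) hj
      · positivity
      · rfl
    · refine Finset.sum_nonpos fun j _ => ?_
      split_ifs with hij
      · simp [w, hi, mt (hadj hij).mpr hi]
      · rfl
  have hexp : ∑ i ∈ S, ∑ j ∈ S, (v i - v j) ^ 2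
      = 2 * (S.card * w ⬝ᵥ w) - 2 * (∑ i ∈ S, v i) ^ 2 := by
    rw [hww]
    simp only [sub_sq, Finset.sum_add_distrib, Finset.sum_sub_distrib, Finset.sum_const,
      nsmul_eq_mul, ← Finset.mul_sum, ← Finset.sum_mul]
    ring
  refine le_of_mul_le_mul_right ?_ hpos
  nlinarith [sq_nonneg (∑ i ∈ S, v i)]

/-! ### Constructing integral spectra -/

/-- The multiset `s` of integers is the Laplacian spectrum of a graph on `N` vertices. -/
def IsLaplacianSpectrum (N : ℕ) (s : Multiset ℤ) : Prop :=
  ∃ G : SimpleGraph (Fin N), laplacianSpectrum G = s.map fun x : ℤ => (x : ℝ)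

namespace IsLaplacianSpectrum

theorem one : IsLaplacianSpectrum 1 {0} := by
  refine ⟨⊥, laplacianSpectrum_eq_of_charpoly ?_⟩
  simp [Matrix.charpoly, Matrix.det_unique, SimpleGraph.lapMatrix, SimpleGraph.degMatrix]

theorem add {M N : ℕ} {s t : Multiset ℤ} (hs : IsLaplacianSpectrum M s)
    (ht : IsLaplacianSpectrum N t) : IsLaplacianSpectrum (M + N) (s + t) := by
  obtain ⟨G, hG⟩ := hs
  obtain ⟨H, hH⟩ := ht
  refine ⟨(G.sum H).map finSumFinEquiv, ?_⟩
  rw [← laplacianSpectrum_congr (SimpleGraph.Iso.map finSumFinEquiv (G.sum H)),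
    laplacianSpectrum_sum, hG, hH, Multiset.map_add]

theorem compl {N : ℕ} {s : Multiset ℤ} (h : IsLaplacianSpectrum N (0 ::ₘ s)) :
    IsLaplacianSpectrum N (0 ::ₘ s.map fun x => N - x) := by
  obtain ⟨G, hG⟩ := h
  refine ⟨Gᶜ, ?_⟩
  rw [laplacianSpectrum_compl (s := s.map fun x : ℤ => (x : ℝ)) (by simpa using hG)]
  simp [Multiset.map_map]

theorem two : IsLaplacianSpectrum 2 {0, 2} := by
  simpa using (one.add one).compl (N := 2) (s := {0})

/-- With distinct nonzero-slot values kept in a `Finset`, spectrum identities reduce to membership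
and linear arithmetic. -/
theorem compl_finset {N : ℕ} {s t : Finset ℤ} (h : IsLaplacianSpectrum N (0 ::ₘ s.val))
    (ht : t = s.image fun x => (N : ℤ) - x) : IsLaplacianSpectrum N (0 ::ₘ t.val) := by
  rw [ht, Finset.image_val_of_injOn (by intro a _ b _ hab; simpa using hab)]
  exact h.compl

/-- Join with a single vertex. -/
theorem cone {N : ℕ} {s t : Finset ℤ} (h : IsLaplacianSpectrum N (0 ::ₘ s.val)) (hs : 0 ∉ s)
    (ht : t = (insert 0 s).image fun x => (N : ℤ) + 1 - x) :
    IsLaplacianSpectrum (N + 1) (0 ::ₘ t.val) := by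
  refine compl_finset (s := insert 0 s) ?_ (by simpa using ht)
  rw [Finset.insert_val_of_notMem hs]
  have := one.add h
  rwa [Multiset.singleton_add, add_comm] at this

/-- Join with the edgeless graph on two vertices. -/
theorem double_cone {N : ℕ} {s t : Finset ℤ} (h : IsLaplacianSpectrum N (0 ::ₘ s.val))
    (hs : 0 ∉ s) (hs2 : 2 ∉ s)
    (ht : t = (insert 0 (insert 2 s)).image fun x => (N : ℤ) + 2 - x) :
    IsLaplacianSpectrum (N + 2) (0 ::ₘ t.val) := by
  refine compl_finset (s := insert 0 (insert 2 s)) ?_ (by simpa using ht)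
  rw [Finset.insert_val_of_notMem (by simp [hs]), Finset.insert_val_of_notMem hs2]
  have := two.add h
  rwa [Multiset.insert_eq_cons, Multiset.cons_add, Multiset.singleton_add,
    Multiset.cons_swap 2, add_comm] at this

/-- The set `{0, …, N} \ {i}` with `0 < i < N` is a Laplacian spectrum if its sum is even. -/
theorem Icc_erase (N : ℕ) : ∀ i : ℕ, 1 ≤ i → i < N →
    ((N % 4 = 0 ∨ N % 4 = 3) ∧ i % 2 = 0 ∨ (N % 4 = 1 ∨ N % 4 = 2) ∧ i % 2 = 1) →
    IsLaplacianSpectrum N (0 ::ₘ ((Finset.Icc 1 (N : ℤ)).erase i).val) := by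
  induction N using Nat.strong_induction_on with
  | _ N ih =>
    intro i hi hiN hpar
    obtain rfl | hi1 := eq_or_lt_of_le hi
    -- A cone would need a smaller graph missing its top value `N - 1`, outside the induction's
    -- range; a double cone over the case missing 2 works, as `two` restores the 2.
    · obtain rfl | hN2 := eq_or_ne N 2
      · have : (Finset.Icc 1 ((2 : ℕ) : ℤ)).erase ((1 : ℕ) : ℤ) = {2} := by decide
        rw [this]
        exact two
      · obtain ⟨M, rfl⟩ : ∃ M, N = M + 2 := ⟨N - 2, by omega⟩
        refine double_cone (ih M (by omega) 2 (by omega) (by omega) (by omega)) (by simp)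
          (by simp) ?_
        ext x
        simp only [Finset.mem_erase, Finset.mem_image, Finset.mem_insert, Finset.mem_Icc]
        push_cast
        exact ⟨fun h => ⟨M + 2 - x, by omega⟩, by rintro ⟨y, hy, rfl⟩; omega⟩
    · obtain ⟨M, rfl⟩ : ∃ M, N = M + 1 := ⟨N - 1, by omega⟩
      refine cone (ih M (by omega) (M + 1 - i) (by omega) (by omega) (by omega)) (by simp) ?_
      ext x
      simp only [Finset.mem_erase, Finset.mem_image, Finset.mem_insert, Finset.mem_Icc]
      rw [Nat.cast_sub hiN.le]
      push_cast
      exact ⟨fun h => ⟨M + 1 - x, by omega⟩, by rintro ⟨y, hy, rfl⟩; omega⟩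

/-- The join of three graphs whose Laplacian spectrum is `{0, n, n, 2, 3, …, n - 1} \ {j}`. -/
theorem cons_Icc_erase {n j : ℕ} (hj : 2 ≤ j) (hjn : j < n)
    (hpar : (n % 4 = 0 ∨ n % 4 = 1) ∧ j % 2 = 1 ∨ (n % 4 = 2 ∨ n % 4 = 3) ∧ j % 2 = 0) :
    IsLaplacianSpectrum n (0 ::ₘ (n : ℤ) ::ₘ ((Finset.Icc 2 (n : ℤ)).erase j).val) := by
  obtain ⟨s, hs, hst⟩ : ∃ s : Finset ℤ, IsLaplacianSpectrum n (0 ::ₘ 0 ::ₘ s.val) ∧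
      (Finset.Icc 2 (n : ℤ)).erase j = s.image fun x => (n : ℤ) - x := by
    -- The complement must miss `n - j`. For `j > 2`, add two isolated vertices to a graph on `n -
    -- 2` vertices; `j = 2` would delete its top value, so a vertex and an edge are added to `n - 3`
    -- vertices instead.
    obtain rfl | hj2 := eq_or_lt_of_le hj
    · obtain rfl | hn3 := eq_or_ne n 3
      · exact ⟨{0}, (one.add one).add one, by decide⟩
      · obtain ⟨M, rfl⟩ : ∃ M, n = M + 3 := ⟨n - 3, by omega⟩
        refine ⟨insert 0 (Finset.Icc 1 M), ?_, ?_⟩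
        · have := (one.add two).add (Icc_erase M 2 (by omega) (by omega) (by omega))
          have h2 : (2 : ℤ) ∈ Finset.Icc 1 (M : ℤ) := by simp; omega
          rw [Finset.insert_val_of_notMem (by simp), ← Finset.insert_erase h2,
            Finset.insert_val_of_notMem (by simp)]
          rw [Multiset.insert_eq_cons, Multiset.singleton_add, Multiset.cons_add,
            Multiset.cons_add, Multiset.singleton_add, Multiset.cons_swap 2, add_comm] at this
          exact this
        · ext x
          simp only [Finset.mem_erase, Finset.mem_image, Finset.mem_insert, Finset.mem_Icc]
          push_cast
          exact ⟨fun h => ⟨M + 3 - x, by omega⟩, by rintro ⟨y, hy, rfl⟩; omega⟩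
    · obtain ⟨M, rfl⟩ : ∃ M, n = M + 2 := ⟨n - 2, by omega⟩
      refine ⟨insert 0 ((Finset.Icc 1 (M : ℤ)).erase ((M + 2 - j : ℕ) : ℤ)), ?_, ?_⟩
      · have := (one.add one).add (Icc_erase M (M + 2 - j) (by omega) (by omega) (by omega))
        rw [Finset.insert_val_of_notMem (by simp)]
        rw [Multiset.singleton_add, Multiset.cons_add, Multiset.singleton_add, add_comm] at this
        exact this
      · ext x
        simp only [Finset.mem_erase, Finset.mem_image, Finset.mem_insert, Finset.mem_Icc]
        rw [Nat.cast_sub hjn.le]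
        push_cast
        exact ⟨fun h => ⟨M + 2 - x, by omega⟩, by rintro ⟨y, hy, rfl⟩; omega⟩
  have := hs.compl
  rw [hst, Finset.image_val_of_injOn (by intro a _ b _ hab; simpa using hab)]
  simpa using this

end IsLaplacianSpectrum

/-! ### Necessary conditions and realization -/

theorem doubledSet_self_eq {n i j : ℕ} (hij : i < j) (hj : j < n) :
    doubledSet n n i j = n ::ₘ (((Finset.range (n + 1)).erase i).erase j).val := by
  rw [doubledSet, Multiset.filter_cons_of_pos _ (by omega)]
  congr 1
  rw [← Finset.range_val, ← Finset.filter_val]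
  congr 1
  ext x
  simp
  tauto

/-- Deleting `n` removes both copies, leaving one element too few. -/
theorem card_doubledSet_self {n i : ℕ} (hij : i < n) : (doubledSet n n i n).card + 1 = n := by
  have : doubledSet n n i n = (((Finset.range (n + 1)).erase i).erase n).val := by
    rw [doubledSet, Multiset.filter_cons_of_neg _ (by simp), ← Finset.range_val,
      ← Finset.filter_val]
    congr 1
    ext x
    simp
    tauto
  rw [this, Finset.card_val, Finset.card_erase_of_mem (by simp; omega),
    Finset.card_erase_of_mem (by simp; omega), Finset.card_range]
  omega

theorem sum_doubledSet {n i j : ℕ} (hij : i < j) (hj : j < n) :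
    (doubledSet n n i j).sum + i + j = n + ∑ x ∈ Finset.range (n + 1), x := by
  have h1 := Finset.sum_erase_add (Finset.range (n + 1)) (fun x => x) (a := i) (by simp; omega)
  have h2 := Finset.sum_erase_add ((Finset.range (n + 1)).erase i) (fun x => x) (a := j)
    (by simp; omega)
  have h3 : ((((Finset.range (n + 1)).erase i).erase j).val).sum
    = ∑ x ∈ ((Finset.range (n + 1)).erase i).erase j, x := by simp [Finset.sum]
  rw [doubledSet_self_eq hij hj, Multiset.sum_cons, h3]
  omega

theorem eq_one_of_realizable_doubledSet {n i j : ℕ} (hi : 0 < i) (hij : i < j) (hj : j < n)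
    (h : LaplacianRealizable n (doubledSet n n i j)) : i = 1 := by
  classical
  obtain ⟨-, -, -, G, -, hG⟩ := h
  by_contra hi1
  obtain ⟨r, hr⟩ : ∃ r, doubledSet n n i j = 0 ::ₘ n ::ₘ n ::ₘ 1 ::ₘ r := by
    obtain ⟨t, ht⟩ := Multiset.exists_cons_of_mem
      (a := 0) (s := (Multiset.range n).filter fun x => x ≠ i ∧ x ≠ j) (by simp; omega)
    obtain ⟨r, hr⟩ := Multiset.exists_cons_of_mem (a := 1) (s := t) (by
      have : 1 ∈ (Multiset.range n).filter fun x => x ≠ i ∧ x ≠ j := by simp; omega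
      rw [ht] at this
      simpa using this)
    refine ⟨r, ?_⟩
    rw [doubledSet, Multiset.range_succ, Multiset.filter_cons_of_pos _ (by omega),
      Multiset.filter_cons_of_pos _ (by omega), ht, hr, Multiset.cons_swap n 0,
      Multiset.cons_swap n 0]
  have hc := laplacianSpectrum_compl (s := (n ::ₘ n ::ₘ 1 ::ₘ r).map fun x : ℕ => (x : ℝ))
    (G := G) (by simpa [hr] using hG)
  obtain ⟨c, hcard⟩ := le_card_supp_of_mem_laplacianSpectrum (G := Gᶜ) (μ := n - 1)
    (by rw [hc]; simp)
  have h3 : 3 ≤ Nat.card Gᶜ.ConnectedComponent := by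
    rw [card_connectedComponent_eq_count_zero, hc]
    simp
  rw [Nat.card_eq_fintype_card, ← Finset.card_univ] at h3
  obtain ⟨d, hd⟩ : ∃ d, d ≠ c := by
    by_contra! hall
    have := Finset.card_le_card (t := {c}) fun d (_ : d ∈ Finset.univ) => by simp [hall d]
    rw [Finset.card_singleton] at this
    exact absurd (h3.trans this) (by norm_num)
  obtain ⟨e, hec, hed⟩ : ∃ e, e ≠ c ∧ e ≠ d := by
    by_contra! hall
    have := Finset.card_le_card (t := {c, d}) fun e (_ : e ∈ Finset.univ) => by
      by_cases he : e = c
      · simp [he]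
      · simp [hall e he]
    exact absurd (h3.trans this) (by have := Finset.card_le_two (a := c) (b := d); omega)
  induction d using SimpleGraph.ConnectedComponent.ind with | _ a
  induction e using SimpleGraph.ConnectedComponent.ind with | _ b
  have hab : a ≠ b := by rintro rfl; exact hed rfl
  have hsub : c.supp ⊆ (({a, b} : Set (Fin n)))ᶜ := by
    intro x hx
    rw [SimpleGraph.ConnectedComponent.mem_supp_iff] at hx
    simp only [Set.mem_compl_iff, Set.mem_insert_iff, Set.mem_singleton_iff, not_or]
    exact ⟨by rintro rfl; exact hd hx, by rintro rfl; exact hec hx⟩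
  have h1 := Set.ncard_le_ncard hsub
  have h2 := Set.ncard_add_ncard_compl ({a, b} : Set (Fin n))
  rw [Set.ncard_pair hab, Nat.card_eq_fintype_card, Fintype.card_fin] at h2
  have h4 : ((c.supp.ncard + 2 : ℕ) : ℝ) ≤ n := by
    exact_mod_cast (by omega : c.supp.ncard + 2 ≤ n)
  push_cast at h4
  linarith

theorem even_sum_of_realizable {n : ℕ} {s : Multiset ℕ} (h : LaplacianRealizable n s) :
    Even s.sum := by
  classical
  obtain ⟨-, -, -, G, -, hG⟩ := h
  have := sum_laplacianSpectrum G
  rw [hG] at this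
  have h2 : (s.map fun x : ℕ => (x : ℝ)).sum = (s.sum : ℝ) := by simp
  rw [h2] at this
  exact ⟨_, (Nat.cast_injective this).trans (two_mul _)⟩

theorem realizable_doubledSet {n j : ℕ} (hj : 2 ≤ j) (hjn : j < n)
    (hpar : (n % 4 = 0 ∨ n % 4 = 1) ∧ j % 2 = 1 ∨ (n % 4 = 2 ∨ n % 4 = 3) ∧ j % 2 = 0) :
    LaplacianRealizable n (doubledSet n n 1 j) := by
  obtain ⟨G, hG⟩ := IsLaplacianSpectrum.cons_Icc_erase hj hjn hpar
  have hmap : ((0 ::ₘ (n : ℤ) ::ₘ ((Finset.Icc 2 (n : ℤ)).erase j).val).map fun x : ℤ => (x : ℝ))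
      = (doubledSet n n 1 j).map fun x : ℕ => (x : ℝ) := by
    have hset : insert 0 ((Finset.Icc 2 (n : ℤ)).erase j)
        = (((Finset.range (n + 1)).erase 1).erase j).map Nat.castEmbedding := by
      ext x
      simp only [Finset.mem_insert, Finset.mem_erase, Finset.mem_Icc, Finset.mem_map,
        Finset.mem_range, Nat.castEmbedding_apply]
      exact ⟨fun h => ⟨x.toNat, by omega⟩, by rintro ⟨y, hy, rfl⟩; omega⟩
    have hval := congrArg (fun s : Finset ℤ => s.val.map fun x : ℤ => (x : ℝ)) hset
    rw [Multiset.cons_swap, doubledSet_self_eq hj hjn,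
      ← Finset.insert_val_of_notMem (a := (0 : ℤ)) (by simp), Multiset.map_cons,
      Multiset.map_cons, hval, Finset.map_val, Multiset.map_map]
    simp only [Function.comp_def, Nat.castEmbedding_apply, Int.cast_natCast]
  rw [hmap] at hG
  refine ⟨?_, ?_, ?_, G, ?_, hG⟩
  · simp [doubledSet]
    omega
  · rw [doubledSet_self_eq hj hjn, Multiset.card_cons, Finset.card_val,
      Finset.card_erase_of_mem (by simp; omega), Finset.card_erase_of_mem (by simp; omega),
      Finset.card_range]
    omega
  · simp [doubledSet]
    omega
  · have h1 := card_connectedComponent_eq_count_zero G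
    have hn0 : n ≠ 0 := by omega
    have hcount : ((doubledSet n n 1 j).map fun x : ℕ => (x : ℝ)).count 0 = 1 := by
      rw [show (0 : ℝ) = ((0 : ℕ) : ℝ) by simp,
        Multiset.count_map_eq_count' _ _ Nat.cast_injective, doubledSet_self_eq hj hjn,
        Multiset.count_cons_of_ne hn0.symm]
      exact Multiset.count_eq_one_of_mem (Finset.nodup _) (by
        simp only [Finset.mem_val, Finset.mem_erase, Finset.mem_range]; omega)
    rw [hG, hcount, Nat.card_eq_one_iff_unique] at h1
    have := h1.1
    have : Nonempty (Fin n) := ⟨⟨0, by omega⟩⟩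
    exact ⟨fun u v => SimpleGraph.ConnectedComponent.exact (Subsingleton.elim _ _)⟩

theorem mainTheorem1 (n : ℕ) (hn : 3 ≤ n) (i j : ℕ) (hi : 0 < i) (hij : i < j) (hj : j ≤ n) :
    LaplacianRealizable n (doubledSet n n i j) ↔
      i = 1 ∧
        ((n ≡ 0 [MOD 4] ∧ ∃ k : ℕ, 1 ≤ k ∧ k ≤ (n - 2) / 2 ∧ j = 2 * k + 1) ∨
         (n ≡ 1 [MOD 4] ∧ ∃ k : ℕ, 1 ≤ k ∧ k ≤ (n - 3) / 2 ∧ j = 2 * k + 1) ∨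
         (n ≡ 2 [MOD 4] ∧ ∃ k : ℕ, 1 ≤ k ∧ k ≤ (n - 2) / 2 ∧ j = 2 * k) ∨
         (n ≡ 3 [MOD 4] ∧ ∃ k : ℕ, 1 ≤ k ∧ k ≤ (n - 1) / 2 ∧ j = 2 * k)) := by
  simp only [Nat.ModEq]
  constructor
  · intro h
    obtain rfl | hjn := eq_or_lt_of_le hj
    · have := card_doubledSet_self hij
      have := h.2.1
      omega
    obtain rfl := eq_one_of_realizable_doubledSet hi hij hjn h
    refine ⟨rfl, ?_⟩
    obtain ⟨m, hm⟩ := even_sum_of_realizable h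
    have hsum := sum_doubledSet hij hjn
    have hgauss := Finset.sum_range_id_mul_two (n + 1)
    -- Now `n(n+1)/2` has the parity of `r(r+1)/2`, up to an even multiple of `q`; `q * q` is a mere
    -- atom for `omega`.
    obtain ⟨q, r, hr, rfl⟩ : ∃ q r, r < 4 ∧ n = 4 * q + r :=
      ⟨n / 4, n % 4, Nat.mod_lt _ (by norm_num), (Nat.div_add_mod n 4).symm⟩
    have hexp : (4 * q + r + 1) * (4 * q + r + 1 - 1)
        = 4 * (4 * (q * q) + 2 * (q * r) + q) + r * r + r := by
      rw [Nat.add_sub_cancel]; ring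
    rw [hexp] at hgauss
    interval_cases r
    · exact Or.inl ⟨by omega, j / 2, by omega⟩
    · exact Or.inr (Or.inl ⟨by omega, j / 2, by omega⟩)
    · exact Or.inr (Or.inr (Or.inl ⟨by omega, j / 2, by omega⟩))
    · exact Or.inr (Or.inr (Or.inr ⟨by omega, j / 2, by omega⟩))
  · rintro ⟨rfl, ⟨hn, k, hk⟩ | ⟨hn, k, hk⟩ | ⟨hn, k, hk⟩ | ⟨hn, k, hk⟩⟩ <;>
      exact realizable_doubledSet (by omega) (by omega) (by omega)
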